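/- Let $d\in\{1,2,3\}$, let $\Omega\subset\mathbb{R}^d$ be a bounded domain, let $V\in L^\infty(\Omega)$ with $V\ge 0$, let $\beta\ge 0$, and let $M_0\in\mathbb{R}$. All functions are real-valued. Put $$\mathcal M=\{u\in H_0^1(\Omega):\ \|u\|_{L^2}=1,\ \|u\|_{L^\infty}\le M_0\},\qquad E(u)=\int_\Omega\Big(|\nabla u|^2+V|u|^2+\tfrac{\beta}{2}|u|^4\Big)\,dx .$$ For $z,w\in H_0^1(\Omega)$ and $u\in\mathcal M$ let $$(z,w)_{a_0}=\int_\Omega \nabla z\cdot\nabla w+Vzw,\qquad (z,w)_{a_u}=\int_\Omega \nabla z\cdot\nabla w+Vzw+\beta|u|^2zw ,$$ with norms $\|\cdot\|_{a_0}$, $\|\cdot\|_{a_u}$. Let $\mathcal G_u$ be the Green's function of $(\cdot,\cdot)_{a_u}$, that is, $\mathcal G_uf\in H_0^1(\Omega)$ and $(z,\mathcal G_uf)_{a_u}=(z,f)_{L^2}$ for all $z\in H_0^1(\Omega)$. Let $\nabla_{a_u}E(u)\in H_0^1(\Omega)$ be the Sobolev gradient of $E$ at $u$, that is, $(\nabla_{a_u}E(u),w)_{a_u}=\frac12\frac{d}{dt}E(u+tw)\big|_{t=0}$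 for all $w\in H_0^1(\Omega)\cap L^\infty(\Omega)$ (the factor $\frac12$ corresponds to the normalization $\nabla E(u)=-\Delta u+Vu+\beta|u|^2u$), and let $$\operatorname{grad}E(u)=\nabla_{a_u}E(u)-\frac{(\nabla_{a_u}E(u),u)_{L^2}}{(\mathcal G_uu,\mathcal G_uu)_{a_u}}\,\mathcal G_uu$$ be the manifold gradient, i.e. its projection onto the tangent space of $\mathcal M$ at $u$. Finally let $R(u)=u/\|u\|_{L^2}$. Let $0<\tau_{\min}\le\tau_{\max}$. Then there is a constant $C_S>0$, depending only on $\Omega,V,\beta,M_0,\tau_{\min},\tau_{\max}$, such that for every sequence of step sizes $\tau_n\in[\tau_{\min},\tau_{\max}]$ and every sequence $(u_n)_{n\ge 0}\subset\mathcal M$ generated by the Sobolev projected gradient descent $u_{n+1}=R\big(u_n-\tau_n\operatorname{grad}E(u_n)\big)$, the step-size condition $$\|u_{n+1}-u_n\|_{a_0}\ \ge\ C_S\,\|\operatorname{grad}E(u_n)\|_{a_{u_n}}$$ holds for all $n\ge 0$. -/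

import Mathlib

open MeasureTheory Filter Topology
open scoped ContDiff Gradient ENNReal

noncomputable section

namespace GrossPitaevskii

/-! ### The Sobolev space `H₀¹(Ω)` -/

/-- The ambient Euclidean space `ℝᵈ`. -/
abbrev Space (d : ℕ) : Type := EuclideanSpace ℝ (Fin d)

/-- The real space `L²(Ω)`. -/
abbrev LTwo {d : ℕ} (Ω : Set (Space d)) : Type :=
  Lp ℝ 2 ((volume : Measure (Space d)).restrict Ω)

/-- The space `L²(Ω; ℝᵈ)`. -/
abbrev LTwoVec {d : ℕ} (Ω : Set (Space d)) : Type :=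
  Lp (Space d) 2 ((volume : Measure (Space d)).restrict Ω)

/-- `L²(Ω) × L²(Ω; ℝᵈ)`, with norm `‖(u, g)‖² = ‖u‖² + ‖g‖²`. On pairs `(u, ∇u)` this is the
`H¹(Ω)` norm. -/
abbrev Ambient {d : ℕ} (Ω : Set (Space d)) : Type :=
  WithLp 2 (LTwo Ω × LTwoVec Ω)

/-- Test functions: `φ ∈ C_c^∞(Ω)`. -/
def IsTest {d : ℕ} (Ω : Set (Space d)) (φ : Space d → ℝ) : Prop :=
  ContDiff ℝ ∞ φ ∧ HasCompactSupport φ ∧ tsupport φ ⊆ Ω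

/-- `g` is the weak gradient of `u` on `Ω`:
`∫_Ω u ∂_e φ = - ∫_Ω (g · e) φ` for all test functions `φ` and all directions `e`. -/
def IsWeakGradient {d : ℕ} (Ω : Set (Space d)) (u : LTwo Ω) (g : LTwoVec Ω) : Prop :=
  ∀ φ : Space d → ℝ, IsTest Ω φ → ∀ e : Space d,
    ∫ x in Ω, u x * fderiv ℝ φ x e = - ∫ x in Ω, inner ℝ (g x) e * φ x

/-- The pairs `(φ, ∇φ)` with `φ ∈ C_c^∞(Ω)`, as a subspace of `L²(Ω) × L²(Ω; ℝᵈ)`. -/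
def testPairs {d : ℕ} (Ω : Set (Space d)) : Submodule ℝ (Ambient Ω) where
  carrier := {p | ∃ φ : Space d → ℝ, IsTest Ω φ ∧
    p.fst =ᵐ[(volume : Measure (Space d)).restrict Ω] φ ∧
    p.snd =ᵐ[(volume : Measure (Space d)).restrict Ω] ∇ φ}
  zero_mem' := by
    refine ⟨fun _ => 0, ⟨contDiff_const, HasCompactSupport.zero, ?_⟩, ?_, ?_⟩
    · simp [tsupport]
    · exact Lp.coeFn_zero _ _ _
    · filter_upwards [Lp.coeFn_zero (Space d) 2 ((volume : Measure (Space d)).restrict Ω)]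
        with x hx
      simpa [gradient] using hx
  add_mem' := by
    rintro p q ⟨φ, ⟨h1, h2, h3⟩, h4, h5⟩ ⟨ψ, ⟨k1, k2, k3⟩, k4, k5⟩
    refine ⟨φ + ψ, ⟨h1.add k1, h2.add k2, ?_⟩, ?_, ?_⟩
    · exact (tsupport_add φ ψ).trans (Set.union_subset h3 k3)
    · filter_upwards [Lp.coeFn_add p.fst q.fst, h4, k4] with x hx a b
      rw [WithLp.add_fst, hx, Pi.add_apply, Pi.add_apply, a, b]
    · filter_upwards [Lp.coeFn_add p.snd q.snd, h5, k5] with x hx a b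
      rw [WithLp.add_snd, hx, Pi.add_apply, a, b]
      simp only [gradient]
      rw [fderiv_add (h1.differentiable (by simp) x) (k1.differentiable (by simp) x), map_add]
  smul_mem' := by
    rintro c p ⟨φ, ⟨h1, h2, h3⟩, h4, h5⟩
    refine ⟨c • φ, ⟨h1.const_smul c, ?_, ?_⟩, ?_, ?_⟩
    · exact h2.smul_left (f := fun _ => c)
    · exact (tsupport_smul_subset_right (fun _ => c) φ).trans h3
    · filter_upwards [Lp.coeFn_smul c p.fst, h4] with x hx a
      rw [WithLp.smul_fst, hx, Pi.smul_apply, Pi.smul_apply, a]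
    · filter_upwards [Lp.coeFn_smul c p.snd, h5] with x hx a
      rw [WithLp.smul_snd, hx, Pi.smul_apply, a]
      simp only [gradient]
      rw [fderiv_const_smul (h1.differentiable (by simp) x), map_smul]

/-- The Sobolev space `H₀¹(Ω)`: the closure of `C_c^∞(Ω)` in the `H¹(Ω)` norm. An element is
recorded together with its weak gradient. -/
def HZeroOne {d : ℕ} (Ω : Set (Space d)) : Submodule ℝ (Ambient Ω) :=
  (testPairs Ω).topologicalClosure

/-- The `L²(Ω)` function underlying an element of `H₀¹(Ω)`. -/
def toFn {d : ℕ} {Ω : Set (Space d)} (u : HZeroOne Ω) : LTwo Ω := (u : Ambient Ω).fst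

/-- The weak gradient of an element of `H₀¹(Ω)`; see `isWeakGradient_wgrad`. -/
def wgrad {d : ℕ} {Ω : Set (Space d)} (u : HZeroOne Ω) : LTwoVec Ω := (u : Ambient Ω).snd

/-- Sanity check: the second component of an element of `H₀¹(Ω)` is the weak gradient of the
first one. -/
theorem isWeakGradient_wgrad {d : ℕ} {Ω : Set (Space d)} (u : HZeroOne Ω) :
    IsWeakGradient Ω (toFn u) (wgrad u) := by
  intro φ hφ e
  obtain ⟨h1, h2, h3⟩ := hφ
  have hdc : Continuous fun x => fderiv ℝ φ x e :=
    (h1.continuous_fderiv (by simp)).clm_apply continuous_const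
  have hds : HasCompactSupport fun x => fderiv ℝ φ x e := h2.fderiv_apply ℝ e
  have hA : MemLp (fun x => fderiv ℝ φ x e) 2 ((volume : Measure (Space d)).restrict Ω) :=
    (hdc.memLp_of_hasCompactSupport hds).restrict Ω
  have hec : Continuous fun x => φ x • e := h1.continuous.smul continuous_const
  have hes : HasCompactSupport fun x => φ x • e := h2.smul_right
  have hB : MemLp (fun x => φ x • e) 2 ((volume : Measure (Space d)).restrict Ω) :=
    (hec.memLp_of_hasCompactSupport hes).restrict Ω
  have e1 : ∀ p : LTwo Ω, ∫ x in Ω, p x * fderiv ℝ φ x e = inner ℝ p (hA.toLp _) := by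
    intro p
    rw [L2.inner_def]
    refine integral_congr_ae ?_
    filter_upwards [hA.coeFn_toLp] with x hx
    rw [hx]
    simp [mul_comm]
  have e2 : ∀ p : LTwoVec Ω, ∫ x in Ω, inner ℝ (p x) e * φ x = inner ℝ p (hB.toLp _) := by
    intro p
    rw [L2.inner_def]
    refine integral_congr_ae ?_
    filter_upwards [hB.coeFn_toLp] with x hx
    rw [hx, inner_smul_right, mul_comm]
  have hcl : IsClosed {p : Ambient Ω | ∫ x in Ω, p.fst x * fderiv ℝ φ x e =
      - ∫ x in Ω, inner ℝ (p.snd x) e * φ x} := by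
    simp only [e1, e2]
    refine isClosed_eq ?_ ?_
    · exact (WithLp.prod_continuous_ofLp 2 _ _).fst.inner continuous_const
    · exact ((WithLp.prod_continuous_ofLp 2 _ _).snd.inner continuous_const).neg
  have hsub : (testPairs Ω : Set (Ambient Ω)) ⊆ {p : Ambient Ω |
      ∫ x in Ω, p.fst x * fderiv ℝ φ x e = - ∫ x in Ω, inner ℝ (p.snd x) e * φ x} := by
    rintro p ⟨ψ, ⟨k1, k2, k3⟩, k4, k5⟩
    have t1 : ∫ x in Ω, p.fst x * fderiv ℝ φ x e = ∫ x, ψ x * fderiv ℝ φ x e := by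
      rw [← setIntegral_eq_integral_of_forall_compl_eq_zero (s := Ω)
        (f := fun x => ψ x * fderiv ℝ φ x e)]
      · refine integral_congr_ae ?_
        filter_upwards [k4] with x hx
        rw [hx]
      · intro x hx
        rw [image_eq_zero_of_notMem_tsupport fun h => hx (k3 h), zero_mul]
    have t2 : ∫ x in Ω, inner ℝ (p.snd x) e * φ x = ∫ x, fderiv ℝ ψ x e * φ x := by
      rw [← setIntegral_eq_integral_of_forall_compl_eq_zero (s := Ω)
        (f := fun x => fderiv ℝ ψ x e * φ x)]
      · refine integral_congr_ae ?_
        filter_upwards [k5] with x hx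
        rw [hx]
        simp [gradient]
      · intro x hx
        rw [image_eq_zero_of_notMem_tsupport fun h => hx (h3 h), mul_zero]
    change ∫ x in Ω, p.fst x * fderiv ℝ φ x e = - ∫ x in Ω, inner ℝ (p.snd x) e * φ x
    rw [t1, t2]
    have hψc : Continuous fun x => fderiv ℝ ψ x e :=
      (k1.continuous_fderiv (by simp)).clm_apply continuous_const
    refine integral_mul_fderiv_eq_neg_fderiv_mul_of_integrable ?_ ?_ ?_
      (fun x _ => k1.differentiable (by simp) x) (fun x _ => h1.differentiable (by simp) x)
    · exact (hψc.mul h1.continuous).integrable_of_hasCompactSupport h2.mul_left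
    · exact (k1.continuous.mul hdc).integrable_of_hasCompactSupport k2.mul_right
    · exact (k1.continuous.mul h1.continuous).integrable_of_hasCompactSupport k2.mul_right
  exact closure_minimal hsub hcl u.2

/-- `u ∈ L^∞(Ω)`. -/
def IsEssBounded {d : ℕ} {Ω : Set (Space d)} (u : HZeroOne Ω) : Prop :=
  eLpNorm (toFn u) ⊤ ((volume : Measure (Space d)).restrict Ω) < ⊤

/-! ### Energy, constraint set and inner products -/

/-- The Gross-Pitaevskii energy `E(u) = ∫_Ω |∇u|² + V |u|² + (β/2) |u|⁴`. -/
def energy {d : ℕ} {Ω : Set (Space d)} (V : Space d → ℝ) (β : ℝ) (u : HZeroOne Ω) : ℝ :=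
  ∫ x in Ω, (‖wgrad u x‖ ^ 2 + V x * |toFn u x| ^ 2 + β / 2 * |toFn u x| ^ 4)

/-- The constraint set `𝓜 = {u ∈ H₀¹(Ω) : ‖u‖_{L²} = 1, ‖u‖_{L^∞} ≤ M₀}`. -/
def constraintSet {d : ℕ} (Ω : Set (Space d)) (M₀ : ℝ) : Set (HZeroOne Ω) :=
  {u | ‖toFn u‖ = 1 ∧
    eLpNorm (toFn u) ⊤ ((volume : Measure (Space d)).restrict Ω) ≤ ENNReal.ofReal M₀}

/-- The fixed inner product `(z, w)_{a₀} = ∫_Ω ∇z · ∇w + V z w`. -/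
def innerA0 {d : ℕ} {Ω : Set (Space d)} (V : Space d → ℝ) (z w : HZeroOne Ω) : ℝ :=
  ∫ x in Ω, (inner ℝ (wgrad z x) (wgrad w x) + V x * toFn z x * toFn w x)

/-- The norm `‖z‖_{a₀}`. -/
def normA0 {d : ℕ} {Ω : Set (Space d)} (V : Space d → ℝ) (z : HZeroOne Ω) : ℝ :=
  Real.sqrt (innerA0 V z z)

/-- The adaptive inner product `(z, w)_{a_u} = ∫_Ω ∇z · ∇w + V z w + β |u|² z w`. -/
def innerA {d : ℕ} {Ω : Set (Space d)} (V : Space d → ℝ) (β : ℝ) (u z w : HZeroOne Ω) : ℝ :=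
  ∫ x in Ω, (inner ℝ (wgrad z x) (wgrad w x) + V x * toFn z x * toFn w x
    + β * |toFn u x| ^ 2 * toFn z x * toFn w x)

/-- The norm `‖z‖_{a_u}`. -/
def normA {d : ℕ} {Ω : Set (Space d)} (V : Space d → ℝ) (β : ℝ) (u z : HZeroOne Ω) : ℝ :=
  Real.sqrt (innerA V β u z z)

/-! ### The Green's function, the gradient and the iteration -/

/-- The Green's function `𝒢_u f ∈ H₀¹(Ω)` of `(·,·)_{a_u}`: the element with
`(z, 𝒢_u f)_{a_u} = (z, f)_{L²}` for all `z ∈ H₀¹(Ω)`. -/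
def green {d : ℕ} {Ω : Set (Space d)} (V : Space d → ℝ) (β : ℝ) (u f : HZeroOne Ω) :
    HZeroOne Ω :=
  Classical.epsilon fun g : HZeroOne Ω =>
    ∀ z : HZeroOne Ω, innerA V β u z g = inner ℝ (toFn z) (toFn f)

/-- `g = ∇_{a_u} E(u)`, the Sobolev gradient of `E` at `u` with respect to `(·,·)_{a_u}`:
the energy has the directional derivative `2 (g, w)_{a_u}` at `u` in every direction
`w ∈ H₀¹(Ω) ∩ L^∞(Ω)`. The factor `2` is the customary normalization
`∇E(u) = -Δu + V u + β |u|² u` (half of the derivative of `E`). -/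
def IsSobolevGradient {d : ℕ} {Ω : Set (Space d)} (V : Space d → ℝ) (β : ℝ)
    (u g : HZeroOne Ω) : Prop :=
  ∀ w : HZeroOne Ω, IsEssBounded w →
    HasDerivAt (fun t : ℝ => energy V β (u + t • w)) (2 * innerA V β u g w) 0

/-- The Sobolev gradient `∇_{a_u} E(u) ∈ H₀¹(Ω)`. -/
def sobolevGradient {d : ℕ} {Ω : Set (Space d)} (V : Space d → ℝ) (β : ℝ) (u : HZeroOne Ω) :
    HZeroOne Ω :=
  Classical.epsilon fun g : HZeroOne Ω => IsSobolevGradient V β u g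

/-- The projection onto the tangent space `{ξ : (ξ, u)_{L²} = 0}` at `u`,
`P ξ = ξ - (ξ, u)_{L²} / (𝒢_u u, 𝒢_u u)_{a_u} 𝒢_u u`. -/
def tangentProjection {d : ℕ} {Ω : Set (Space d)} (V : Space d → ℝ) (β : ℝ)
    (u ξ : HZeroOne Ω) : HZeroOne Ω :=
  ξ - (inner ℝ (toFn ξ) (toFn u) / innerA V β u (green V β u u) (green V β u u)) •
    green V β u u

/-- The manifold gradient `grad E(u) = P (∇_{a_u} E(u))`. -/
def gradE {d : ℕ} {Ω : Set (Space d)} (V : Space d → ℝ) (β : ℝ) (u : HZeroOne Ω) :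
    HZeroOne Ω :=
  tangentProjection V β u (sobolevGradient V β u)

/-- The retraction `R(u) = u / ‖u‖_{L²}`. -/
def retraction {d : ℕ} {Ω : Set (Space d)} (u : HZeroOne Ω) : HZeroOne Ω :=
  ‖toFn u‖⁻¹ • u

/-- `(u_n)` is a sequence in `𝓜` generated by the Sobolev projected gradient descent with step
sizes `(τ_n)`: `u_{n+1} = R(u_n - τ_n grad E(u_n))`. -/
def IsSobolevPGD {d : ℕ} {Ω : Set (Space d)} (V : Space d → ℝ) (β M₀ : ℝ) (τ : ℕ → ℝ)
    (u : ℕ → HZeroOne Ω) : Prop :=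
  (∀ n, u n ∈ constraintSet Ω M₀) ∧
    ∀ n, u (n + 1) = retraction (u n - τ n • gradE V β (u n))

end GrossPitaevskii

end

noncomputable section

namespace GrossPitaevskii

variable {d : ℕ} {Ω : Set (Space d)}

/-! ### Elementary facts on `H₀¹(Ω)` -/

/-! The form `a_u` freezes the weight `|u|²` at the current iterate, so half the derivative of `E`
at `u` is `(u, ·)_{a_u}` and the Sobolev gradient of `E` at `u` is `u` itself
(`sobolevGradient_eq`). Hence `g = grad E(u)` is `u` minus a multiple of `𝒢_u u`; it is
`L²`-orthogonal to `u`, which is the same as being `a_u`-orthogonal to `𝒢_u u`, and so `(g, u)_{a_u}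
= (g, g)_{a_u}` (`gradE_tangent_and_projection`).

By Pythagoras `‖u - τ g‖_{L²} ≥ 1`, so the retraction scales by some `s ∈ (0, 1]` and the step is
`-((1 - s) u + s τ g)`. Since `‖g‖_{a_u} ≤ ‖u‖_{a_u}` and the cross term is a nonnegative multiple
of `‖g‖²_{a_u}`, its `a_u`-norm is at least `(1 - s + s τ) ‖g‖_{a_u} ≥ min 1 τ · ‖g‖_{a_u}`
(`innerA_gradE_le_step`). The `L^∞` bound and the Poincaré inequality let `a₀` control `a_u`
uniformly on the constraint set (`innerA_le_innerA0`), which turns this into the claim. -/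

lemma toFn_add (z w : HZeroOne Ω) : toFn (z + w) = toFn z + toFn w := rfl
lemma toFn_sub (z w : HZeroOne Ω) : toFn (z - w) = toFn z - toFn w := rfl
lemma toFn_smul (c : ℝ) (z : HZeroOne Ω) : toFn (c • z) = c • toFn z := rfl
lemma wgrad_add (z w : HZeroOne Ω) : wgrad (z + w) = wgrad z + wgrad w := rfl
lemma wgrad_smul (c : ℝ) (z : HZeroOne Ω) : wgrad (c • z) = c • wgrad z := rfl

lemma norm_sq_eq (z : HZeroOne Ω) : ‖z‖ ^ 2 = ‖toFn z‖ ^ 2 + ‖wgrad z‖ ^ 2 :=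
  WithLp.prod_norm_sq_eq_of_L2 (z : Ambient Ω)

lemma norm_toFn_le (z : HZeroOne Ω) : ‖toFn z‖ ≤ ‖z‖ := by
  refine abs_le_of_sq_le_sq' ?_ (norm_nonneg _) |>.2
  rw [norm_sq_eq]; nlinarith [sq_nonneg ‖wgrad z‖]

lemma norm_wgrad_le (z : HZeroOne Ω) : ‖wgrad z‖ ≤ ‖z‖ := by
  refine abs_le_of_sq_le_sq' ?_ (norm_nonneg _) |>.2
  rw [norm_sq_eq]; nlinarith [sq_nonneg ‖toFn z‖]

instance : CompleteSpace (HZeroOne Ω) :=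
  (testPairs Ω).isClosed_topologicalClosure.completeSpace_coe

/-- A closed condition that holds on test functions holds on `H₀¹(Ω)`. -/
lemma HZeroOne.induction {P : HZeroOne Ω → Prop} (hP : IsClosed {z | P z})
    (h : ∀ z : HZeroOne Ω, (z : Ambient Ω) ∈ testPairs Ω → P z) (z : HZeroOne Ω) : P z := by
  have hd : Dense {z : HZeroOne Ω | (z : Ambient Ω) ∈ testPairs Ω} := by
    rw [Subtype.dense_iff]
    intro x hx
    refine closure_mono ?_ hx
    intro y hy
    exact ⟨⟨y, (testPairs Ω).le_topologicalClosure hy⟩, hy, rfl⟩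
  exact (hP.closure_subset_iff.2 h) (hd z)

/-- Makes test functions admissible directions in `IsSobolevGradient`, which only probes bounded
ones. -/
lemma isEssBounded_of_mem_testPairs {z : HZeroOne Ω} (hz : (z : Ambient Ω) ∈ testPairs Ω) :
    IsEssBounded z := by
  obtain ⟨φ, ⟨h1, h2, -⟩, h4, -⟩ := hz
  have h : MemLp φ ⊤ ((volume : Measure (Space d)).restrict Ω) :=
    (h1.continuous.memLp_of_hasCompactSupport h2).restrict Ω
  unfold IsEssBounded toFn
  rw [eLpNorm_congr_ae h4]
  exact h.2

/-! ### The Poincaré inequality -/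

lemma integral_mul_le_norm_mul_norm (f g : LTwo Ω) : ∫ x in Ω, |f x| * |g x| ≤ ‖f‖ * ‖g‖ := by
  have h := real_inner_le_norm |f| |g|
  rw [norm_abs_eq_norm, norm_abs_eq_norm, L2.inner_def] at h
  refine le_of_eq_of_le (integral_congr_ae ?_) h
  filter_upwards [Lp.coeFn_abs f, Lp.coeFn_abs g] with x hf hg
  rw [hf, hg]; simp [mul_comm]

lemma integrable_abs_mul_norm {E : Type*} [NormedAddCommGroup E]
    (f : LTwo Ω) (g : Lp E 2 ((volume : Measure (Space d)).restrict Ω)) :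
    Integrable (fun x => |f x| * ‖g x‖) (volume.restrict Ω) :=
  (Lp.memLp f).abs.integrable_mul (Lp.memLp g).norm

lemma integral_abs_mul_norm_le {E : Type*} [NormedAddCommGroup E]
    (f : LTwo Ω) (g : Lp E 2 ((volume : Measure (Space d)).restrict Ω)) :
    ∫ x in Ω, |f x| * ‖g x‖ ≤ ‖f‖ * ‖g‖ := by
  have hg := (Lp.memLp g).norm
  have h := integral_mul_le_norm_mul_norm f (hg.toLp _)
  rw [Lp.norm_toLp, eLpNorm_norm, ← Lp.norm_def] at h
  refine le_of_eq_of_le (integral_congr_ae ?_) h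
  filter_upwards [hg.coeFn_toLp] with x hx
  rw [hx, abs_norm]

lemma norm_sq_LTwo (f : LTwo Ω) : ‖f‖ ^ 2 = ∫ x in Ω, f x ^ 2 := by
  rw [← real_inner_self_eq_norm_sq, L2.inner_def]
  simp

/-- Integrate by parts against `xᵢ φ` in direction `eᵢ`: this gives `‖φ‖² = -2 ∫ φ xᵢ ∂ᵢφ`, and
`|xᵢ| ≤ R` on `Ω` with Cauchy–Schwarz bounds the right side by `2 R ‖φ‖ ‖∇φ‖`. -/
theorem poincare_of_mem_testPairs (i : Fin d) {R : ℝ} (hR0 : 0 ≤ R) (hR : ∀ x ∈ Ω, ‖x‖ ≤ R)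
    (hΩ : MeasurableSet Ω)
    (z : HZeroOne Ω) (hz : (z : Ambient Ω) ∈ testPairs Ω) : ‖toFn z‖ ≤ 2 * R * ‖wgrad z‖ := by
  obtain ⟨φ, ⟨h1, h2, h3⟩, h4, h5⟩ := hz
  change toFn z =ᵐ[_] φ at h4
  change wgrad z =ᵐ[_] ∇ φ at h5
  have hψ : IsTest Ω (fun x => x i * φ x) :=
    ⟨((EuclideanSpace.proj (𝕜 := ℝ) i).contDiff).mul h1, h2.mul_left,
      (tsupport_mul_subset_right (f := fun x : Space d => x i)).trans h3⟩
  set e : Space d := EuclideanSpace.single i 1 with he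
  have hw := isWeakGradient_wgrad z _ hψ e
  have hd : ∀ x, fderiv ℝ (fun x : Space d => x i * φ x) x e
      = φ x + x i * inner ℝ (∇ φ x) e := by
    intro x
    have := ((EuclideanSpace.proj (𝕜 := ℝ) i).hasFDerivAt (x := x)).mul
      (h1.differentiable (by simp) x).hasFDerivAt
    have h' : fderiv ℝ (fun x : Space d => x i * φ x) x = _ := this.fderiv
    rw [h']
    simp [gradient, he]
    ring
  have hxi : ∀ᵐ x ∂(volume.restrict Ω : Measure (Space d)), |x i| ≤ R := by
    filter_upwards [ae_restrict_mem hΩ] with x hx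
    exact (PiLp.norm_apply_le x i).trans (hR x hx)
  have hine : ∀ v : Space d, |inner ℝ v e| ≤ ‖v‖ := by
    intro v
    simpa [he] using abs_real_inner_le_norm v e
  have hint : Integrable (fun x => toFn z x * (x i * inner ℝ (wgrad z x) e))
      (volume.restrict Ω) := by
    refine Integrable.mono' ((integrable_abs_mul_norm (toFn z) (wgrad z)).const_mul R) ?_ ?_
    · refine (Lp.aestronglyMeasurable _).mul (AEStronglyMeasurable.mul ?_ ?_)
      · exact (EuclideanSpace.proj (𝕜 := ℝ) i).continuous.aestronglyMeasurable
      · exact (Lp.aestronglyMeasurable _).inner aestronglyMeasurable_const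
    · filter_upwards [hxi] with x hx
      rw [norm_mul, norm_mul, Real.norm_eq_abs, Real.norm_eq_abs, Real.norm_eq_abs]
      have := mul_le_mul hx (hine (wgrad z x)) (abs_nonneg _) hR0
      nlinarith [abs_nonneg (toFn z x)]
  have hsq : Integrable (fun x => toFn z x ^ 2) (volume.restrict Ω) :=
    (Lp.memLp (toFn z)).integrable_sq
  have e1 : ∫ x in Ω, toFn z x * fderiv ℝ (fun x : Space d => x i * φ x) x e
      = ‖toFn z‖ ^ 2 + ∫ x in Ω, toFn z x * (x i * inner ℝ (wgrad z x) e) := by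
    rw [norm_sq_LTwo, ← integral_add hsq hint]
    refine integral_congr_ae ?_
    filter_upwards [h4, h5] with x hx hx'
    rw [hd, ← hx, ← hx']; ring
  have e2 : ∫ x in Ω, inner ℝ (wgrad z x) e * (x i * φ x)
      = ∫ x in Ω, toFn z x * (x i * inner ℝ (wgrad z x) e) := by
    refine integral_congr_ae ?_
    filter_upwards [h4] with x hx
    rw [← hx]; ring
  rw [e1, e2] at hw
  have hb : |∫ x in Ω, toFn z x * (x i * inner ℝ (wgrad z x) e)|
      ≤ R * (‖toFn z‖ * ‖wgrad z‖) := by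
    rw [← Real.norm_eq_abs]
    refine (norm_integral_le_of_norm_le
      ((integrable_abs_mul_norm (toFn z) (wgrad z)).const_mul R) ?_).trans ?_
    · filter_upwards [hxi] with x hx
      rw [norm_mul, norm_mul, Real.norm_eq_abs, Real.norm_eq_abs, Real.norm_eq_abs]
      have := mul_le_mul hx (hine (wgrad z x)) (abs_nonneg _) hR0
      nlinarith [abs_nonneg (toFn z x)]
    · rw [integral_const_mul]
      exact mul_le_mul_of_nonneg_left (integral_abs_mul_norm_le _ _) hR0
  have hb' := neg_abs_le (∫ x in Ω, toFn z x * (x i * inner ℝ (wgrad z x) e))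
  -- The estimate so far is quadratic in `‖toFn z‖`; one factor is cancelled when it is nonzero.
  rcases (norm_nonneg (toFn z)).eq_or_lt with h0 | h0
  · rw [← h0]; positivity
  · refine le_of_mul_le_mul_left ?_ h0
    nlinarith

theorem exists_poincare (hd : 0 < d) (hΩo : IsOpen Ω) (hΩb : Bornology.IsBounded Ω) :
    ∃ C : ℝ, 0 ≤ C ∧ ∀ z : HZeroOne Ω, ‖toFn z‖ ≤ C * ‖wgrad z‖ := by
  obtain ⟨R, hR0, hR⟩ := hΩb.exists_pos_norm_le
  refine ⟨2 * R, by positivity, HZeroOne.induction ?_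
    (poincare_of_mem_testPairs ⟨0, hd⟩ hR0.le hR hΩo.measurableSet)⟩
  have c1 : Continuous (toFn : HZeroOne Ω → LTwo Ω) :=
    ((WithLp.prod_continuous_ofLp 2 _ _).fst).comp continuous_subtype_val
  have c2 : Continuous (wgrad : HZeroOne Ω → LTwoVec Ω) :=
    ((WithLp.prod_continuous_ofLp 2 _ _).snd).comp continuous_subtype_val
  exact isClosed_le c1.norm (continuous_const.mul c2.norm)

/-! ### Bilinear forms with a bounded potential -/

lemma integrable_bdd_mul_mul {W : Space d → ℝ} (hW : MemLp W ⊤ (volume.restrict Ω))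
    (f g : LTwo Ω) : Integrable (fun x => W x * f x * g x) (volume.restrict Ω) :=
  ((Lp.memLp f).mul (r := 2) hW).integrable_mul (Lp.memLp g)

lemma integrable_inner_wgrad (z w : HZeroOne Ω) :
    Integrable (fun x => inner ℝ (wgrad z x) (wgrad w x)) (volume.restrict Ω) :=
  L2.integrable_inner (𝕜 := ℝ) (wgrad z) (wgrad w)

/-- The form `∫_Ω ∇z · ∇w + W z w`. -/
def potentialForm (Ω : Set (Space d)) (W : Space d → ℝ) (z w : HZeroOne Ω) : ℝ :=
  ∫ x in Ω, (inner ℝ (wgrad z x) (wgrad w x) + W x * toFn z x * toFn w x)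

lemma potentialForm_eq {W : Space d → ℝ} (hW : MemLp W ⊤ (volume.restrict Ω))
    (z w : HZeroOne Ω) : potentialForm Ω W z w =
      inner ℝ (wgrad z) (wgrad w) + ∫ x in Ω, W x * toFn z x * toFn w x := by
  rw [L2.inner_def]
  exact integral_add (integrable_inner_wgrad z w) (integrable_bdd_mul_mul hW _ _)

lemma potentialForm_comm (W : Space d → ℝ) (z w : HZeroOne Ω) :
    potentialForm Ω W z w = potentialForm Ω W w z := by
  refine integral_congr_ae (Eventually.of_forall fun x => ?_)
  simp only [real_inner_comm (wgrad z x)]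
  ring

lemma potentialForm_add_left {W : Space d → ℝ} (hW : MemLp W ⊤ (volume.restrict Ω))
    (z z' w : HZeroOne Ω) :
    potentialForm Ω W (z + z') w = potentialForm Ω W z w + potentialForm Ω W z' w := by
  have h : ∫ x in Ω, W x * toFn (z + z') x * toFn w x
      = (∫ x in Ω, W x * toFn z x * toFn w x) + ∫ x in Ω, W x * toFn z' x * toFn w x := by
    rw [← integral_add (integrable_bdd_mul_mul hW _ _) (integrable_bdd_mul_mul hW _ _)]
    refine integral_congr_ae ?_
    filter_upwards [Lp.coeFn_add (toFn z) (toFn z')] with x hx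
    rw [toFn_add, hx, Pi.add_apply]; ring
  rw [potentialForm_eq hW, potentialForm_eq hW, potentialForm_eq hW, h, wgrad_add, inner_add_left]
  ring

lemma potentialForm_smul_left {W : Space d → ℝ} (hW : MemLp W ⊤ (volume.restrict Ω))
    (c : ℝ) (z w : HZeroOne Ω) :
    potentialForm Ω W (c • z) w = c * potentialForm Ω W z w := by
  have h : ∫ x in Ω, W x * toFn (c • z) x * toFn w x
      = c * ∫ x in Ω, W x * toFn z x * toFn w x := by
    rw [← integral_const_mul]
    refine integral_congr_ae ?_
    filter_upwards [Lp.coeFn_smul c (toFn z)] with x hx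
    rw [toFn_smul, hx, Pi.smul_apply, smul_eq_mul]; ring
  rw [potentialForm_eq hW, potentialForm_eq hW, h, wgrad_smul, real_inner_smul_left]
  ring

lemma abs_integral_bdd_mul_mul_le {W : Space d → ℝ} {K : ℝ} (hK : 0 ≤ K)
    (hWK : ∀ᵐ x ∂(volume.restrict Ω), |W x| ≤ K) (f g : LTwo Ω) :
    |∫ x in Ω, W x * f x * g x| ≤ K * (‖f‖ * ‖g‖) := by
  rw [← Real.norm_eq_abs]
  refine (norm_integral_le_of_norm_le ((integrable_abs_mul_norm f g).const_mul K) ?_).trans ?_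
  · filter_upwards [hWK] with x hx
    rw [norm_mul, norm_mul, mul_assoc]
    exact mul_le_mul_of_nonneg_right hx (by positivity)
  · rw [integral_const_mul]
    exact mul_le_mul_of_nonneg_left (integral_abs_mul_norm_le _ _) hK

lemma ae_abs_le_of_memLp_top {W : Space d → ℝ} (hW : MemLp W ⊤ (volume.restrict Ω)) :
    ∀ᵐ x ∂(volume.restrict Ω), |W x| ≤ (eLpNorm W ⊤ (volume.restrict Ω)).toReal := by
  filter_upwards [ae_le_eLpNormEssSup (f := W) (μ := volume.restrict Ω)] with x hx
  rw [← eLpNorm_exponent_top] at hx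
  simpa using ENNReal.toReal_mono hW.2.ne hx

/-- `potentialForm` as a bounded bilinear form. -/
def potentialFormCLM {W : Space d → ℝ} (hW : MemLp W ⊤ (volume.restrict Ω)) :
    HZeroOne Ω →L[ℝ] HZeroOne Ω →L[ℝ] ℝ :=
  LinearMap.mkContinuous₂
    (LinearMap.mk₂ ℝ (potentialForm Ω W) (potentialForm_add_left hW)
      (potentialForm_smul_left hW)
      (fun z w w' => by
        simp only [potentialForm_comm W z, potentialForm_add_left hW])
      (fun c z w => by
        simp only [potentialForm_comm W z, potentialForm_smul_left hW, smul_eq_mul]))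
    (1 + (eLpNorm W ⊤ (volume.restrict Ω)).toReal) (by
      intro z w
      rw [LinearMap.mk₂_apply, potentialForm_eq hW, Real.norm_eq_abs]
      have h1 := abs_real_inner_le_norm (wgrad z) (wgrad w)
      have h2 := abs_integral_bdd_mul_mul_le ENNReal.toReal_nonneg (ae_abs_le_of_memLp_top hW)
        (toFn z) (toFn w)
      have h3 : ‖wgrad z‖ * ‖wgrad w‖ ≤ ‖z‖ * ‖w‖ := by
        gcongr <;> exact norm_wgrad_le _
      have h4 : ‖toFn z‖ * ‖toFn w‖ ≤ ‖z‖ * ‖w‖ := by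
        gcongr <;> exact norm_toFn_le _
      have h5 := mul_le_mul_of_nonneg_left h4
        (ENNReal.toReal_nonneg (a := eLpNorm W ⊤ (volume.restrict Ω)))
      refine (abs_add_le _ _).trans ?_
      linarith)

@[simp] lemma potentialFormCLM_apply {W : Space d → ℝ} (hW : MemLp W ⊤ (volume.restrict Ω))
    (z w : HZeroOne Ω) : potentialFormCLM hW z w = potentialForm Ω W z w := rfl

lemma norm_wgrad_sq_le_potentialForm {W : Space d → ℝ} (hW : MemLp W ⊤ (volume.restrict Ω))
    (hW0 : ∀ᵐ x ∂(volume.restrict Ω), 0 ≤ W x) (z : HZeroOne Ω) :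
    ‖wgrad z‖ ^ 2 ≤ potentialForm Ω W z z := by
  rw [potentialForm_eq hW, real_inner_self_eq_norm_sq, le_add_iff_nonneg_right]
  refine integral_nonneg_of_ae ?_
  filter_upwards [hW0] with x hx
  rw [mul_assoc]
  exact mul_nonneg hx (mul_self_nonneg _)

/-- The gradient term alone controls the full norm: Poincaré gives `‖z‖² ≤ (C² + 1) ‖∇z‖²`, and a
nonnegative potential only helps. -/
lemma isCoercive_potentialFormCLM {W : Space d → ℝ} (hW : MemLp W ⊤ (volume.restrict Ω))
    (hW0 : ∀ᵐ x ∂(volume.restrict Ω), 0 ≤ W x) {C : ℝ}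
    (hC : ∀ z : HZeroOne Ω, ‖toFn z‖ ≤ C * ‖wgrad z‖) : IsCoercive (potentialFormCLM hW) := by
  refine ⟨(C ^ 2 + 1)⁻¹, by positivity, fun z => ?_⟩
  rw [potentialFormCLM_apply, mul_assoc, inv_mul_le_iff₀ (by positivity), ← sq, norm_sq_eq]
  have h1 := norm_wgrad_sq_le_potentialForm hW hW0 z
  have h2 := pow_le_pow_left₀ (norm_nonneg _) (hC z) 2
  have h3 := mul_le_mul_of_nonneg_left h1 (sq_nonneg C)
  nlinarith

lemma eq_zero_of_potentialForm_self_eq_zero {W : Space d → ℝ}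
    (hW : MemLp W ⊤ (volume.restrict Ω)) (hW0 : ∀ᵐ x ∂(volume.restrict Ω), 0 ≤ W x) {C : ℝ}
    (hC : ∀ z : HZeroOne Ω, ‖toFn z‖ ≤ C * ‖wgrad z‖) {z : HZeroOne Ω}
    (hz : potentialForm Ω W z z = 0) : z = 0 := by
  obtain ⟨c, hc, h⟩ := isCoercive_potentialFormCLM hW hW0 hC
  have := h z
  rw [potentialFormCLM_apply, hz] at this
  by_contra hne
  have := norm_pos_iff.2 hne
  have : 0 < c * ‖z‖ * ‖z‖ := by positivity
  linarith

/-- The `L²(Ω)` function underlying an element of `H₀¹(Ω)`, as a bounded linear map. -/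
def toFnCLM : HZeroOne Ω →L[ℝ] LTwo Ω :=
  LinearMap.mkContinuous { toFun := toFn, map_add' := toFn_add, map_smul' := toFn_smul } 1
    (fun z => by simpa using norm_toFn_le z)

/-- Lax–Milgram applied to the Riesz representative of `z ↦ (f, z)_{L²}`. -/
lemma exists_green {W : Space d → ℝ} (hW : MemLp W ⊤ (volume.restrict Ω))
    (hW0 : ∀ᵐ x ∂(volume.restrict Ω), 0 ≤ W x) {C : ℝ}
    (hC : ∀ z : HZeroOne Ω, ‖toFn z‖ ≤ C * ‖wgrad z‖) (f : HZeroOne Ω) :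
    ∃ g : HZeroOne Ω, ∀ z, potentialForm Ω W z g = inner ℝ (toFn z) (toFn f) := by
  have hco := isCoercive_potentialFormCLM hW hW0 hC
  let ℓ : HZeroOne Ω →L[ℝ] ℝ := (innerSL ℝ (toFn f)).comp toFnCLM
  refine ⟨hco.continuousLinearEquivOfBilin.symm ((InnerProductSpace.toDual ℝ _).symm ℓ),
    fun z => ?_⟩
  have h := hco.continuousLinearEquivOfBilin_apply
    (hco.continuousLinearEquivOfBilin.symm ((InnerProductSpace.toDual ℝ _).symm ℓ)) z
  rw [ContinuousLinearEquiv.apply_symm_apply, InnerProductSpace.toDual_symm_apply,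
    potentialFormCLM_apply, potentialForm_comm] at h
  rw [← h, real_inner_comm]
  rfl

/-! ### The forms `(·,·)_{a_u}` -/

lemma IsEssBounded.memLp {u : HZeroOne Ω} (hu : IsEssBounded u) :
    MemLp (toFn u) ⊤ (volume.restrict Ω) :=
  ⟨Lp.aestronglyMeasurable _, hu⟩

lemma isEssBounded_of_mem_constraintSet {M₀ : ℝ} {u : HZeroOne Ω} (hu : u ∈ constraintSet Ω M₀) :
    IsEssBounded u :=
  hu.2.trans_lt ENNReal.ofReal_lt_top

/-- The potential `V + β |u|²`. -/
def potential (V : Space d → ℝ) (β : ℝ) (u : HZeroOne Ω) : Space d → ℝ :=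
  fun x => V x + β * (toFn u x * toFn u x)

lemma memLp_mul_top {f g : Space d → ℝ} (hf : MemLp f ⊤ (volume.restrict Ω))
    (hg : MemLp g ⊤ (volume.restrict Ω)) :
    MemLp (fun x => f x * g x) ⊤ (volume.restrict Ω) :=
  hg.mul (r := ⊤) hf

lemma memLp_potential {V : Space d → ℝ} (hV : MemLp V ⊤ (volume.restrict Ω)) (β : ℝ)
    {u : HZeroOne Ω} (hu : IsEssBounded u) : MemLp (potential V β u) ⊤ (volume.restrict Ω) :=
  hV.add ((memLp_mul_top hu.memLp hu.memLp).const_mul β)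

lemma potential_nonneg {V : Space d → ℝ} (hV0 : ∀ᵐ x ∂(volume.restrict Ω), 0 ≤ V x)
    {β : ℝ} (hβ : 0 ≤ β) (u : HZeroOne Ω) :
    ∀ᵐ x ∂(volume.restrict Ω), 0 ≤ potential V β u x := by
  filter_upwards [hV0] with x hx
  exact add_nonneg hx (mul_nonneg hβ (mul_self_nonneg _))

/-- For bounded `u` this makes `a_u` an instance of the forms with bounded potential, so that
coercivity and Lax–Milgram apply. -/
lemma innerA_eq (V : Space d → ℝ) (β : ℝ) (u z w : HZeroOne Ω) :
    innerA V β u z w = potentialForm Ω (potential V β u) z w := by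
  refine integral_congr_ae (Eventually.of_forall fun x => ?_)
  simp only [potential, sq_abs]
  ring

/-- The extra term satisfies `∫ β|u|²z² ≤ β M₀² ‖z‖² ≤ β M₀² C² ‖∇z‖²`, and `‖∇z‖²` is at most the
`a₀`-form. -/
lemma innerA_le_innerA0 {V : Space d → ℝ} (hV : MemLp V ⊤ (volume.restrict Ω))
    (hV0 : ∀ᵐ x ∂(volume.restrict Ω), 0 ≤ V x) {β M₀ : ℝ} (hβ : 0 ≤ β) {C : ℝ}
    (hC : ∀ z : HZeroOne Ω, ‖toFn z‖ ≤ C * ‖wgrad z‖) {u : HZeroOne Ω}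
    (hu : u ∈ constraintSet Ω M₀) (z : HZeroOne Ω) :
    innerA V β u z z ≤ (1 + β * M₀ ^ 2 * C ^ 2) * innerA0 V z z := by
  have hb := isEssBounded_of_mem_constraintSet hu
  have huM : ∀ᵐ x ∂(volume.restrict Ω), |β * (toFn u x * toFn u x)| ≤ β * M₀ ^ 2 := by
    filter_upwards [ae_abs_le_of_memLp_top hb.memLp] with x hx
    -- `M₀` has no sign assumption; passing to `|M₀|` is harmless because only `M₀²` enters.
    have h1 : (eLpNorm (toFn u) ⊤ (volume.restrict Ω)).toReal ≤ |M₀| :=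
      ENNReal.toReal_le_of_le_ofReal (abs_nonneg _)
        (hu.2.trans (ENNReal.ofReal_le_ofReal (le_abs_self _)))
    rw [abs_mul, abs_of_nonneg hβ, ← sq, abs_of_nonneg (sq_nonneg (toFn u x))]
    exact mul_le_mul_of_nonneg_left (sq_le_sq.2 (hx.trans h1)) hβ
  have hI := le_of_abs_le
    (abs_integral_bdd_mul_mul_le (by positivity) huM (toFn z) (toFn z))
  have hsplit : innerA V β u z z
      = innerA0 V z z + ∫ x in Ω, β * (toFn u x * toFn u x) * toFn z x * toFn z x := by
    refine Eq.trans ?_ (integral_add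
      ((integrable_inner_wgrad z z).add (integrable_bdd_mul_mul hV (toFn z) (toFn z)))
      (integrable_bdd_mul_mul ((memLp_mul_top hb.memLp hb.memLp).const_mul β)
        (toFn z) (toFn z)))
    refine integral_congr_ae (Eventually.of_forall fun x => ?_)
    simp only [sq_abs]
    ring
  have h1 : ‖wgrad z‖ ^ 2 ≤ innerA0 V z z := norm_wgrad_sq_le_potentialForm hV hV0 z
  have h2 := pow_le_pow_left₀ (norm_nonneg _) (hC z) 2
  have h3 : ‖toFn z‖ * ‖toFn z‖ ≤ C ^ 2 * innerA0 V z z := by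
    nlinarith [mul_le_mul_of_nonneg_left h1 (sq_nonneg C)]
  have h4 := mul_le_mul_of_nonneg_left h3 (show 0 ≤ β * M₀ ^ 2 by positivity)
  linarith

/-! ### The Sobolev gradient -/

lemma integral_quartic {α : Type*} [MeasurableSpace α] {μ : Measure α}
    {f₀ f₁ f₂ f₃ f₄ : α → ℝ} (h₀ : Integrable f₀ μ) (h₁ : Integrable f₁ μ)
    (h₂ : Integrable f₂ μ) (h₃ : Integrable f₃ μ) (h₄ : Integrable f₄ μ) (t : ℝ) :
    ∫ x, (f₀ x + t * f₁ x + t ^ 2 * f₂ x + t ^ 3 * f₃ x + t ^ 4 * f₄ x) ∂μ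
      = (∫ x, f₀ x ∂μ) + t * (∫ x, f₁ x ∂μ) + t ^ 2 * (∫ x, f₂ x ∂μ)
        + t ^ 3 * (∫ x, f₃ x ∂μ) + t ^ 4 * (∫ x, f₄ x ∂μ) := by
  have i₁ := h₀.add (h₁.const_mul t)
  have i₂ := i₁.add (h₂.const_mul (t ^ 2))
  have i₃ := i₂.add (h₃.const_mul (t ^ 3))
  simp only [← integral_const_mul]
  rw [← integral_add' h₀ (h₁.const_mul t), ← integral_add' i₁ (h₂.const_mul (t ^ 2)),
    ← integral_add' i₂ (h₃.const_mul (t ^ 3)), ← integral_add' i₃ (h₄.const_mul (t ^ 4))]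
  rfl

/-- Boundedness of `u` and `w` makes every coefficient in the expansion of the density in powers of
`t` integrable. Only the linear coefficient matters for the derivative at `0`. -/
lemma energy_add_smul {V : Space d → ℝ} (hV : MemLp V ⊤ (volume.restrict Ω)) (β : ℝ)
    {u w : HZeroOne Ω} (hu : IsEssBounded u) (hw : IsEssBounded w) :
    ∃ a b c e : ℝ, ∀ t : ℝ, energy V β (u + t • w)
      = a + t * (2 * innerA V β u u w) + t ^ 2 * b + t ^ 3 * c + t ^ 4 * e := by
  have i0 := integrable_inner_wgrad u u
  have i1 := integrable_inner_wgrad u w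
  have i2 := integrable_inner_wgrad w w
  have v0 := integrable_bdd_mul_mul hV (toFn u) (toFn u)
  have v1 := integrable_bdd_mul_mul hV (toFn u) (toFn w)
  have v2 := integrable_bdd_mul_mul hV (toFn w) (toFn w)
  have huu := memLp_mul_top hu.memLp hu.memLp
  have hww := memLp_mul_top hw.memLp hw.memLp
  have q0 := (integrable_bdd_mul_mul huu (toFn u) (toFn u)).const_mul (β / 2)
  have q1 := (integrable_bdd_mul_mul huu (toFn u) (toFn w)).const_mul β
  have q2 := (integrable_bdd_mul_mul huu (toFn w) (toFn w)).const_mul (3 * β)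
  have q3 := (integrable_bdd_mul_mul hww (toFn u) (toFn w)).const_mul (2 * β)
  have q4 := (integrable_bdd_mul_mul hww (toFn w) (toFn w)).const_mul (β / 2)
  have key := integral_quartic ((i0.add v0).add q0) (((i1.add v1).add q1).const_mul 2)
    ((i2.add v2).add q2) q3 q4
  have hA : 2 * innerA V β u u w = ∫ x in Ω, 2 * (inner ℝ (wgrad u x) (wgrad w x)
      + V x * toFn u x * toFn w x + β * (toFn u x * toFn u x * toFn u x * toFn w x)) := by
    rw [innerA, ← integral_const_mul]
    refine integral_congr_ae (Eventually.of_forall fun x => ?_)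
    simp only [sq_abs]
    ring
  rw [hA]
  -- The remaining coefficients are read off from `key` by unification.
  refine ⟨_, _, _, _, fun t => Eq.trans ?_ (key t)⟩
  refine integral_congr_ae ?_
  filter_upwards [Lp.coeFn_add (toFn u) (t • toFn w), Lp.coeFn_smul t (toFn w),
    Lp.coeFn_add (wgrad u) (t • wgrad w), Lp.coeFn_smul t (wgrad w)] with x h1 h2 h3 h4
  rw [toFn_add, toFn_smul, wgrad_add, wgrad_smul, h1, h3, Pi.add_apply, Pi.add_apply, h2, h4,
    Pi.smul_apply, Pi.smul_apply, norm_add_sq_real, norm_smul, inner_smul_right, sq_abs,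
    (by decide : Even 4).pow_abs, mul_pow, Real.norm_eq_abs, sq_abs, smul_eq_mul]
  simp only [Pi.add_apply, real_inner_self_eq_norm_sq]
  ring

lemma isSobolevGradient_self {V : Space d → ℝ} (hV : MemLp V ⊤ (volume.restrict Ω)) (β : ℝ)
    {u : HZeroOne Ω} (hu : IsEssBounded u) : IsSobolevGradient V β u u := by
  intro w hw
  obtain ⟨a, b, c, e, h⟩ := energy_add_smul hV β hu hw
  rw [funext h]
  have hid := hasDerivAt_id (0 : ℝ)
  have := ((((hid.mul_const (2 * innerA V β u u w)).const_add a).add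
    ((hid.pow 2).mul_const b)).add ((hid.pow 3).mul_const c)).add ((hid.pow 4).mul_const e)
  exact this.congr_deriv (by simp)

/-- Since the gradient is a chosen element, uniqueness is needed: two candidates agree against
bounded directions, hence against all by density and continuity, and the form is definite. -/
theorem sobolevGradient_eq {V : Space d → ℝ} (hV : MemLp V ⊤ (volume.restrict Ω))
    (hV0 : ∀ᵐ x ∂(volume.restrict Ω), 0 ≤ V x) {β : ℝ} (hβ : 0 ≤ β) {C : ℝ}
    (hC : ∀ z : HZeroOne Ω, ‖toFn z‖ ≤ C * ‖wgrad z‖)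
    {u : HZeroOne Ω} (hu : IsEssBounded u) : sobolevGradient V β u = u := by
  have hself := isSobolevGradient_self hV β hu
  have hg : IsSobolevGradient V β u (sobolevGradient V β u) :=
    Classical.epsilon_spec (p := fun g => IsSobolevGradient V β u g) ⟨u, hself⟩
  set g := sobolevGradient V β u
  have hW := memLp_potential hV β hu
  have key : ∀ w, potentialFormCLM hW g w = potentialFormCLM hW u w := by
    refine HZeroOne.induction ?_ ?_
    · exact isClosed_eq (potentialFormCLM hW g).continuous (potentialFormCLM hW u).continuous
    · intro w hw
      have hw := isEssBounded_of_mem_testPairs hw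
      have := (hg w hw).unique (hself w hw)
      rw [innerA_eq, innerA_eq] at this
      simpa using this
  refine sub_eq_zero.1 (eq_zero_of_potentialForm_self_eq_zero hW
    (potential_nonneg hV0 hβ u) hC ?_)
  rw [← potentialFormCLM_apply hW, map_sub (potentialFormCLM hW), sub_apply, key, sub_self]

/-! ### The descent step -/

theorem green_spec {V : Space d → ℝ} (hV : MemLp V ⊤ (volume.restrict Ω))
    (hV0 : ∀ᵐ x ∂(volume.restrict Ω), 0 ≤ V x) {β : ℝ} (hβ : 0 ≤ β) {C : ℝ}
    (hC : ∀ z : HZeroOne Ω, ‖toFn z‖ ≤ C * ‖wgrad z‖)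
    {u : HZeroOne Ω} (hu : IsEssBounded u) (f z : HZeroOne Ω) :
    innerA V β u z (green V β u f) = inner ℝ (toFn z) (toFn f) := by
  obtain ⟨g, hg⟩ := exists_green (memLp_potential hV β hu) (potential_nonneg hV0 hβ u) hC f
  simp only [← innerA_eq] at hg
  exact Classical.epsilon_spec (p := fun g : HZeroOne Ω =>
    ∀ z : HZeroOne Ω, innerA V β u z g = inner ℝ (toFn z) (toFn f)) ⟨g, hg⟩ z

/-- The manifold gradient is tangent to the `L²` sphere at `u`, and it is the
`(·,·)_{a_u}`-orthogonal projection of `u`. -/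
theorem gradE_tangent_and_projection {V : Space d → ℝ} (hV : MemLp V ⊤ (volume.restrict Ω))
    (hV0 : ∀ᵐ x ∂(volume.restrict Ω), 0 ≤ V x) {β : ℝ} (hβ : 0 ≤ β) {C : ℝ}
    (hC : ∀ z : HZeroOne Ω, ‖toFn z‖ ≤ C * ‖wgrad z‖)
    {u : HZeroOne Ω} (hu : IsEssBounded u) (hu1 : ‖toFn u‖ = 1) :
    inner ℝ (toFn u) (toFn (gradE V β u)) = 0 ∧
      innerA V β u (gradE V β u) u = innerA V β u (gradE V β u) (gradE V β u) := by
  have hW := memLp_potential hV β hu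
  set G := green V β u u with hG
  have hspec : ∀ z, innerA V β u z G = inner ℝ (toFn z) (toFn u) :=
    green_spec hV hV0 hβ hC hu u
  have huu : inner ℝ (toFn u) (toFn u) = (1 : ℝ) := by
    rw [real_inner_self_eq_norm_sq, hu1, one_pow]
  -- If `G` vanished, testing its defining identity with `u` would give `0 = ‖u‖² = 1`.
  have hGG : innerA V β u G G ≠ 0 := by
    intro h
    have h0 : G = 0 := eq_zero_of_potentialForm_self_eq_zero hW (potential_nonneg hV0 hβ u) hC
      (by rw [← innerA_eq, h])
    have := hspec u
    rw [h0, huu, innerA_eq, ← potentialFormCLM_apply hW, map_zero] at this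
    exact zero_ne_one this
  set l := 1 / innerA V β u G G with hl
  have hg : gradE V β u = u - l • G := by
    rw [gradE, tangentProjection, sobolevGradient_eq hV hV0 hβ hC hu, ← hG, huu]
  have htan : inner ℝ (toFn (gradE V β u)) (toFn u) = (0 : ℝ) := by
    rw [hg, toFn_sub, toFn_smul, inner_sub_left, real_inner_smul_left, huu, ← hspec G, hl,
      one_div_mul_cancel hGG, sub_self]
  refine ⟨by rw [real_inner_comm, htan], ?_⟩
  -- Pairing with `G` in `a_u` is pairing with `u` in `L²`, so tangency is `a_u`-orthogonality to
  -- `G`.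
  have h0 : innerA V β u (gradE V β u) G = 0 := by rw [hspec, htan]
  have hu' : u - gradE V β u = l • G := by rw [hg]; abel
  have : potentialFormCLM hW (gradE V β u) (u - gradE V β u) = 0 := by
    rw [hu', map_smul, potentialFormCLM_apply, ← innerA_eq, h0, smul_zero]
  rw [map_sub, potentialFormCLM_apply, potentialFormCLM_apply, ← innerA_eq, ← innerA_eq] at this
  exact sub_eq_zero.1 this

/-- One projected gradient step moves by at least `min 1 τmin` times the gradient, in the
norm `‖·‖_{a_u}`. -/
theorem innerA_gradE_le_step {V : Space d → ℝ} (hV : MemLp V ⊤ (volume.restrict Ω))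
    (hV0 : ∀ᵐ x ∂(volume.restrict Ω), 0 ≤ V x) {β : ℝ} (hβ : 0 ≤ β) {C : ℝ}
    (hC : ∀ z : HZeroOne Ω, ‖toFn z‖ ≤ C * ‖wgrad z‖)
    {u : HZeroOne Ω} (hu : IsEssBounded u) (hu1 : ‖toFn u‖ = 1) {τmin τ : ℝ}
    (hτmin : 0 < τmin) (hτ : τmin ≤ τ) :
    (min 1 τmin) ^ 2 * innerA V β u (gradE V β u) (gradE V β u) ≤
      innerA V β u (retraction (u - τ • gradE V β u) - u)
        (retraction (u - τ • gradE V β u) - u) := by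
  have hW := memLp_potential hV β hu
  obtain ⟨htan, hproj⟩ := gradE_tangent_and_projection hV hV0 hβ hC hu hu1
  set g := gradE V β u
  have hN : 1 ≤ ‖toFn (u - τ • g)‖ := by
    have h : ‖toFn (u - τ • g)‖ ^ 2 = 1 + τ ^ 2 * ‖toFn g‖ ^ 2 := by
      rw [toFn_sub, toFn_smul, norm_sub_sq_real, real_inner_smul_right, htan, hu1, norm_smul,
        mul_pow, Real.norm_eq_abs, sq_abs]
      ring
    refine (one_le_sq_iff₀ (norm_nonneg _)).1 ?_
    rw [h]
    nlinarith [mul_nonneg (sq_nonneg τ) (sq_nonneg ‖toFn g‖)]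
  rw [retraction]
  set s := ‖toFn (u - τ • g)‖⁻¹ with hs
  have hs0 : 0 ≤ s := by positivity
  have hs1 : s ≤ 1 := inv_le_one_of_one_le₀ hN
  have hnn : ∀ z : HZeroOne Ω, 0 ≤ innerA V β u z z := fun z => by
    rw [innerA_eq]
    exact (sq_nonneg _).trans
      (norm_wgrad_sq_le_potentialForm hW (potential_nonneg hV0 hβ u) z)
  have hsymm : innerA V β u u g = innerA V β u g u := by
    rw [innerA_eq, innerA_eq, potentialForm_comm]
  -- Expand `0 ≤ ‖u - g‖²_{a_u}`, using `(g, u)_{a_u} = (g, g)_{a_u}`.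
  have hle : innerA V β u g g ≤ innerA V β u u u := by
    have h := hnn (u - g)
    rw [innerA_eq, ← potentialFormCLM_apply hW] at h
    simp only [map_sub, sub_apply, potentialFormCLM_apply,
      ← innerA_eq, hsymm, hproj] at h
    linarith
  have hexp : innerA V β u (s • (u - τ • g) - u) (s • (u - τ • g) - u)
      = (1 - s) ^ 2 * innerA V β u u u + 2 * (1 - s) * (s * τ) * innerA V β u g g
        + (s * τ) ^ 2 * innerA V β u g g := by
    rw [innerA_eq, ← potentialFormCLM_apply hW]
    simp only [map_sub, map_smul, sub_apply, smul_apply,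
      potentialFormCLM_apply, smul_eq_mul, ← innerA_eq, hsymm, hproj]
    ring
  have hm0 : 0 < min 1 τmin := lt_min one_pos hτmin
  -- The right side is a convex combination of `1` and `τ`.
  have hm1 : min 1 τmin ≤ 1 - s + s * τ := by
    nlinarith [min_le_left 1 τmin, (min_le_right 1 τmin).trans hτ]
  have hm2 := mul_le_mul_of_nonneg_right (pow_le_pow_left₀ hm0.le hm1 2) (hnn g)
  have hm3 := mul_le_mul_of_nonneg_left hle (sq_nonneg (1 - s))
  -- Replacing `(u, u)_{a_u}` by the smaller `(g, g)_{a_u}` completes the square `(1 - s + s τ)²`.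
  rw [hexp]
  nlinarith

end GrossPitaevskii

end

theorem mainTheorem6 {d : ℕ} (hd : d = 1 ∨ d = 2 ∨ d = 3)
    (Ω : Set (GrossPitaevskii.Space d)) (hΩo : IsOpen Ω) (hΩc : IsConnected Ω)
    (hΩb : Bornology.IsBounded Ω)
    (V : GrossPitaevskii.Space d → ℝ) (hV : MemLp V ⊤ (volume.restrict Ω))
    (hV0 : ∀ᵐ x ∂(volume.restrict Ω), 0 ≤ V x)
    (β : ℝ) (hβ : 0 ≤ β) (M₀ τmin τmax : ℝ) (hτmin : 0 < τmin) (hτ : τmin ≤ τmax) :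
    ∃ CS : ℝ, 0 < CS ∧
      ∀ (τ : ℕ → ℝ) (u : ℕ → GrossPitaevskii.HZeroOne Ω),
        (∀ n, τmin ≤ τ n ∧ τ n ≤ τmax) →
        GrossPitaevskii.IsSobolevPGD V β M₀ τ u →
        ∀ n, CS * GrossPitaevskii.normA V β (u n) (GrossPitaevskii.gradE V β (u n)) ≤
          GrossPitaevskii.normA0 V (u (n + 1) - u n) := by
  obtain ⟨C, -, hC⟩ := GrossPitaevskii.exists_poincare (by omega) hΩo hΩb
  have hm : 0 < min 1 τmin := lt_min one_pos hτmin
  have hK : 0 < 1 + β * M₀ ^ 2 * C ^ 2 := by positivity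
  -- The numerator is the step bound in `a_u`; the denominator is the price of passing from `a_u` to
  -- `a₀`.
  refine ⟨min 1 τmin / Real.sqrt (1 + β * M₀ ^ 2 * C ^ 2), by positivity, ?_⟩
  intro τ u hτn hu n
  have hun := hu.1 n
  have h1 := GrossPitaevskii.innerA_gradE_le_step hV hV0 hβ hC
    (GrossPitaevskii.isEssBounded_of_mem_constraintSet hun) hun.1 hτmin (hτn n).1
  rw [← hu.2 n] at h1
  have h2 := h1.trans (GrossPitaevskii.innerA_le_innerA0 hV hV0 hβ hC hun _)
  have h3 := Real.sqrt_le_sqrt h2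
  rw [Real.sqrt_mul (sq_nonneg _), Real.sqrt_mul hK.le, Real.sqrt_sq hm.le] at h3
  rw [div_mul_eq_mul_div, div_le_iff₀ (Real.sqrt_pos.2 hK), mul_comm (GrossPitaevskii.normA0 _ _)]
  exact h3
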